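/- All trees are nonempty subsets of $\mathbb N^*$ closed under initial segments, and $S_n$ denotes the set of strings of length $n$ on a tree $S$. Let $T\subseteq\mathbb N^*$ be a computable (i.e. decidable) finitely branching tree in which every string has at least two successors. Its path space $[T]$ carries the ultrametric $d(f,g)=\max\{|T_n|^{-1} : f(n)\ne g(n)\}$ (with $\max\emptyset=0$). Let $r:\{0,1\}^*\to[T]$ have dense range and let the path $r(u)$ be computable uniformly in $u$ (for instance, $r(u)$ extends the string of $T$ that corresponds to $u$ under the length-lexicographical orderings, when this correspondence is computable). With $C$ the plain Kolmogorov complexity of binary strings, put for $f\in[T]$ and $\alpha>0$ $$C_\alpha(f)=\min\{C(u) : d(f,r(u))\le\alpha\},\qquad \dim(f)=\liminf_{\alpha\to0^+}\frac{C_\alpha(f)}{\log_2(1/\alpha)},\qquad \mathrm{Dim}(f)=\limsup_{\alpha\to0^+}\frac{C_\alpha(f)}{\log_2(1/\alpha)} .$$ For $X\subseteq[T]$ let $N_\alpha(X)$ be the least cardinality of a covering of $X$ by sets of diameter at most $\alpha$, and let $\underline{\dim}_B(X)$ and $\overline{\dim}_B(X)$ be the lower and upper limit of $\log N_\alpha(X)/\log(1/\alpha)$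 as $\alpha\to0^+$. Let $S\subseteq T$ be a computable (decidable) subtree without leaves, and $[S]\subseteq[T]$ the set of its paths. (i) For every $f\in[S]$ we have $\dim(f)\le\underline{\dim}_B([S])$ and $\mathrm{Dim}(f)\le\overline{\dim}_B([S])$. (ii) Suppose that $S$ is level-wise uniformly branching, i.e. for each $n$ all strings in $S_n$ have the same number of successors on $S$. Let $\mu_S$ be the uniform measure on $[S]$: the probability measure for which each string on $S$ distributes its mass evenly among its successors on $S$. If $f\in[S]$ is Martin-Löf random with respect to $\mu_S$, i.e. $f\notin\bigcap_b U_b$ for every sequence of uniformly computably enumerable open sets $U_b\subseteq[S]$ with $\mu_S(U_b)\le2^{-b}$, then $\dim(f)=\underline{\dim}_B([S])$ and $\mathrm{Dim}(f)=\overline{\dim}_B([S])$. -/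

import Mathlib

open MeasureTheory ProbabilityTheory Filter Topology
open scoped ENNReal

/-! ### Kolmogorov complexity of binary strings -/

/-- A universal machine on binary strings. On input `0ᵉ 1 p` it runs the `e`-th program (in the
numbering of codes of partial recursive functions) on the string `p`; strings are passed to and
from programs through their standard encoding as natural numbers. -/
def universalMachine (q : List Bool) : Part (List Bool) :=
  (Nat.Partrec.Code.eval
      (Denumerable.ofNat Nat.Partrec.Code (q.takeWhile (fun b => !b)).length)
      (Encodable.encode (q.dropWhile (fun b => !b)).tail)).bind
    fun m => (Encodable.decode (α := List Bool) m : Part (List Bool))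

/-- The machine is partial computable. -/
theorem partrec_universalMachine : Partrec universalMachine := by
  have h1 : Computable (fun q : List Bool => (q.takeWhile (fun b => !b)).length) := by
    have e : (fun q : List Bool => (q.takeWhile (fun b => !b)).length)
        = fun q : List Bool => List.findIdx (fun b => b) q := by
      funext q
      induction q with
      | nil => rfl
      | cons b l ih => cases b <;> simp [List.findIdx_cons, ih]
    rw [e]
    exact (Primrec.list_findIdx Primrec.id (Primrec.snd.comp Primrec.id).to₂).to_comp
  have h2 : Computable (fun q : List Bool => (q.dropWhile (fun b => !b)).tail) := by
    have e : (fun q : List Bool => (q.dropWhile (fun b => !b)).tail)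
        = fun q : List Bool => List.rec (motive := fun _ => List Bool) []
            (fun b l ih => cond b l ih) q := by
      funext q
      induction q with
      | nil => rfl
      | cons b l ih => cases b <;> simp [ih]
    rw [e]
    refine (Primrec.list_rec (f := fun q : List Bool => q) (g := fun _ => ([] : List Bool))
      (h := fun _ p => cond p.1 p.2.1 p.2.2) Primrec.id (Primrec.const _) ?_).to_comp
    exact (Primrec.cond (Primrec.fst.comp Primrec.snd)
      (Primrec.fst.comp (Primrec.snd.comp Primrec.snd))
      (Primrec.snd.comp (Primrec.snd.comp Primrec.snd))).to₂
  have h3 : Partrec fun q : List Bool => Nat.Partrec.Code.eval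
      (Denumerable.ofNat Nat.Partrec.Code (q.takeWhile (fun b => !b)).length)
      (Encodable.encode (q.dropWhile (fun b => !b)).tail) :=
    Nat.Partrec.Code.eval_part.comp ((Computable.ofNat _).comp h1) (Computable.encode.comp h2)
  exact h3.bind (Computable.decode.comp Computable.snd).ofOption.to₂

/-- The machine is additively optimal among all partial computable machines, so that the
complexity below is the usual one, up to an additive constant. -/
theorem universalMachine_optimal (V : List Bool →. List Bool) (hV : Partrec V) :
    ∃ c : ℕ, ∀ p u : List Bool, u ∈ V p →
      ∃ q : List Bool, u ∈ universalMachine q ∧ q.length ≤ p.length + c := by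
  obtain ⟨code, hcode⟩ := Nat.Partrec.Code.exists_code.1 hV
  refine ⟨Encodable.encode code + 1, fun p u hu =>
    ⟨List.replicate (Encodable.encode code) false ++ true :: p, ?_, by simp; omega⟩⟩
  have e1 : ((List.replicate (Encodable.encode code) false ++ true :: p).takeWhile
      (fun b => !b)).length = Encodable.encode code := by
    rw [List.takeWhile_append_of_pos (by simp)]; simp
  have e2 : ((List.replicate (Encodable.encode code) false ++ true :: p).dropWhile
      (fun b => !b)).tail = p := by
    rw [List.dropWhile_append_of_pos (by simp)]; simp
  unfold universalMachine
  rw [e1, e2, Denumerable.ofNat_encode, hcode]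
  simp only [Encodable.encodek, Part.coe_some, Part.bind_some, Part.mem_bind_iff, Part.mem_map_iff]
  exact ⟨_, ⟨u, hu, rfl⟩, by simp⟩

/-- The plain Kolmogorov complexity `C(u)` of a binary string: the least length of a description
of `u` for the universal machine. -/
noncomputable def plainComplexity (u : List Bool) : ℕ :=
  sInf {k | ∃ q : List Bool, u ∈ universalMachine q ∧ q.length = k}

/-! ### Algorithmic dimension of points and box dimension of sets in a metric space -/

section Metric

variable {M : Type*} [MetricSpace M]

/-- The complexity of a point `w` in the range of `r`: the least `C(u)` over its names `u`. -/
noncomputable def nameComplexity (r : List Bool → M) (w : M) : ℕ :=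
  sInf {k | ∃ u, r u = w ∧ plainComplexity u = k}

/-- The Kolmogorov complexity `C_α(x)` of a point `x` at precision `α`. -/
noncomputable def complexityAtPrecision (r : List Bool → M) (x : M) (α : ℝ) : ℕ :=
  sInf {k | ∃ w ∈ Set.range r, dist x w ≤ α ∧ nameComplexity r w = k}

/-- The algorithmic dimension of a point. -/
noncomputable def algDim (r : List Bool → M) (x : M) : EReal :=
  liminf (fun α : ℝ => (((complexityAtPrecision r x α : ℝ) / Real.logb 2 (1 / α) : ℝ) : EReal))
    (𝓝[>] 0)

/-- The strong algorithmic dimension of a point. -/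
noncomputable def strongAlgDim (r : List Bool → M) (x : M) : EReal :=
  limsup (fun α : ℝ => (((complexityAtPrecision r x α : ℝ) / Real.logb 2 (1 / α) : ℝ) : EReal))
    (𝓝[>] 0)

/-- `N_α(X)`: the least cardinality of a covering of `X` by sets of diameter at most `α`. -/
noncomputable def coverNumber (X : Set M) (α : ℝ) : ℕ∞ :=
  ⨅ (𝒰 : Set (Set M)) (_ : X ⊆ ⋃₀ 𝒰 ∧ ∀ U ∈ 𝒰, Metric.ediam U ≤ ENNReal.ofReal α), 𝒰.encard

/-- The lower box dimension (the quotient of logarithms does not depend on their base). -/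
noncomputable def lowerBoxDim (X : Set M) : EReal :=
  liminf (fun α : ℝ => ENNReal.log (coverNumber X α : ℝ≥0∞) / (Real.log (1 / α) : EReal)) (𝓝[>] 0)

/-- The upper box dimension. -/
noncomputable def upperBoxDim (X : Set M) : EReal :=
  limsup (fun α : ℝ => ENNReal.log (coverNumber X α : ℝ≥0∞) / (Real.log (1 / α) : EReal)) (𝓝[>] 0)

end Metric

/-! ### Trees and their path spaces -/

/-- The initial segment `f ↾ n` of length `n`. -/
def initSeg (f : ℕ → ℕ) (n : ℕ) : List ℕ := (List.range n).map f

/-- A finitely branching tree: a nonempty set of strings of natural numbers that is closed under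
initial segments and in which every string has finitely many successors. -/
structure StringTree where
  carrier : Set (List ℕ)
  nonempty : carrier.Nonempty
  prefix_closed : ∀ σ τ : List ℕ, σ <+: τ → τ ∈ carrier → σ ∈ carrier
  finite_branching : ∀ σ ∈ carrier, {i : ℕ | σ ++ [i] ∈ carrier}.Finite

namespace StringTree

/-- The labels `i` such that `σ ^ i` is a successor of `σ` on the tree. -/
def succs (T : StringTree) (σ : List ℕ) : Set ℕ := {i | σ ++ [i] ∈ T.carrier}

/-- The `n`-th level of the tree. -/
def level (T : StringTree) (n : ℕ) : Set (List ℕ) := {σ ∈ T.carrier | σ.length = n}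

/-- The tree has no leaves. -/
def NoLeaves (T : StringTree) : Prop := ∀ σ ∈ T.carrier, (T.succs σ).Nonempty

/-- Strings on the same level have the same number of successors. -/
def LevelwiseUniformlyBranching (T : StringTree) : Prop :=
  ∀ σ ∈ T.carrier, ∀ τ ∈ T.carrier, σ.length = τ.length → (T.succs σ).ncard = (T.succs τ).ncard

/-- Membership in the tree is decidable by an algorithm. -/
def IsComputable (T : StringTree) : Prop := ComputablePred fun σ : List ℕ => σ ∈ T.carrier

/-- `f` is a path on the tree. -/
def IsPath (T : StringTree) (f : ℕ → ℕ) : Prop := ∀ n, initSeg f n ∈ T.carrier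

theorem nil_mem (T : StringTree) : [] ∈ T.carrier :=
  let ⟨σ, hσ⟩ := T.nonempty
  T.prefix_closed [] σ List.nil_prefix hσ

theorem finite_succs (T : StringTree) (σ : List ℕ) : (T.succs σ).Finite := by
  by_cases h : σ ∈ T.carrier
  · exact T.finite_branching σ h
  · refine Set.Finite.subset Set.finite_empty fun i hi => h ?_
    exact T.prefix_closed _ _ (List.prefix_append _ _) hi

theorem finite_level (T : StringTree) (n : ℕ) : (T.level n).Finite := by
  induction n with
  | zero =>
    refine (Set.finite_singleton ([] : List ℕ)).subset fun σ hσ => ?_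
    exact List.length_eq_zero_iff.1 hσ.2
  | succ n ih =>
    refine (ih.biUnion fun σ _ => (T.finite_succs σ).image fun i => σ ++ [i]).subset ?_
    intro τ hτ
    obtain ⟨h, hl⟩ := hτ
    have hne : τ ≠ [] := by
      intro h0
      simp [h0] at hl
    have e : τ.dropLast ++ [τ.getLast hne] = τ := List.dropLast_append_getLast hne
    refine Set.mem_biUnion (x := τ.dropLast) ⟨?_, by simp [hl]⟩ ⟨τ.getLast hne, ?_, e⟩
    · exact T.prefix_closed _ _ (List.dropLast_prefix τ) h
    · change τ.dropLast ++ [τ.getLast hne] ∈ T.carrier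
      rwa [e]

/-- The path space `[T]`. -/
def Path (T : StringTree) : Type := {f : ℕ → ℕ // T.IsPath f}

/-- The distance of two paths: the maximum of `1 / |T_n|` over the `n` with `f(n) ≠ g(n)`, where
the maximum of the empty set is `0`. -/
noncomputable def pathDist (T : StringTree) (f g : T.Path) : ℝ :=
  ⨆ n : ℕ, if f.1 n = g.1 n then 0 else ((T.level n).ncard : ℝ)⁻¹

theorem bddAbove_pathDist (T : StringTree) (f g : T.Path) :
    BddAbove (Set.range fun n : ℕ =>
      if f.1 n = g.1 n then (0 : ℝ) else ((T.level n).ncard : ℝ)⁻¹) := by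
  refine ⟨1, ?_⟩
  rintro _ ⟨n, rfl⟩
  dsimp only
  split_ifs
  · exact zero_le_one
  · exact Nat.cast_inv_le_one _

noncomputable instance (T : StringTree) : MetricSpace T.Path where
  dist := T.pathDist
  dist_self f := by simp [pathDist]
  dist_comm f g := by simp only [pathDist, eq_comm]
  dist_triangle f g h := by
    have nn : ∀ (a b : T.Path) (n : ℕ),
        (0 : ℝ) ≤ if a.1 n = b.1 n then (0 : ℝ) else ((T.level n).ncard : ℝ)⁻¹ := by
      intro a b n
      split_ifs <;> positivity
    refine ciSup_le fun n => ?_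
    have h1 := le_ciSup (T.bddAbove_pathDist f g) n
    have h2 := le_ciSup (T.bddAbove_pathDist g h) n
    refine le_trans ?_ (add_le_add h1 h2)
    have n1 := nn f g n
    have n2 := nn g h n
    by_cases a : f.1 n = g.1 n
    · rw [a]
      simp
    · by_cases b : f.1 n = h.1 n
      · rw [if_pos b]
        exact add_nonneg n1 n2
      · simpa [a, b] using n2
  eq_of_dist_eq_zero := by
    intro f g hfg
    refine Subtype.ext (funext fun n => ?_)
    by_contra hne
    have h1 := le_ciSup (T.bddAbove_pathDist f g) n
    have hmem : initSeg f.1 n ∈ T.level n := ⟨f.2 n, by simp [initSeg]⟩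
    have hpos : 0 < (T.level n).ncard := (Set.ncard_pos (T.finite_level n)).2 ⟨_, hmem⟩
    have h0 : (⨆ n : ℕ, if f.1 n = g.1 n then (0 : ℝ) else ((T.level n).ncard : ℝ)⁻¹) = 0 := hfg
    rw [h0] at h1
    simp only [if_neg hne] at h1
    have : (0 : ℝ) < ((T.level n).ncard : ℝ)⁻¹ := by positivity
    linarith

/-- For a subtree `S` of `T`, the set `[S]` of its paths as a subset of the space `[T]`. -/
def pathsIn (S T : StringTree) : Set T.Path := {f | S.IsPath f.1}

/-- A computable structure on the metric space `[T]`: a map `r` from binary strings onto a dense set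
of paths such that the path `r(u)` is computable uniformly in `u`. -/
structure IsComputableStructure (T : StringTree) (r : List Bool → T.Path) : Prop where
  dense : DenseRange r
  computable : Computable fun p : List Bool × ℕ => (r p.1).1 p.2

/-! ### The uniform measure on paths and Martin-Löf randomness -/

open Classical in
/-- The law of the next entry after the string `σ`: uniform on the successors of `σ`
(and, as a convention, constantly `0` if `σ` has no successors). -/
noncomputable def succLaw (S : StringTree) (σ : List ℕ) : Measure ℕ :=
  if (S.succs σ).Nonempty then uniformOn (S.succs σ) else Measure.dirac 0

instance (S : StringTree) (σ : List ℕ) : IsProbabilityMeasure (S.succLaw σ) := by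
  unfold succLaw
  split_ifs with h
  · exact isProbabilityMeasure_uniformOn (S.finite_succs σ) h
  · infer_instance

/-- The string of the entries `0, …, n` of a sequence. -/
def historyString {n : ℕ} (x : Finset.Iic n → ℕ) : List ℕ :=
  List.ofFn fun i : Fin (n + 1) => x ⟨i, Finset.mem_Iic.2 (Nat.lt_succ_iff.1 i.2)⟩

/-- The transition kernel: the next entry is uniform on the successors of the current string. -/
noncomputable def stepKernel (S : StringTree) (n : ℕ) : Kernel (Finset.Iic n → ℕ) ℕ :=
  Kernel.ofFunOfCountable fun x => S.succLaw (historyString x)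

instance (S : StringTree) (n : ℕ) : IsMarkovKernel (S.stepKernel n) :=
  ⟨fun x => inferInstanceAs (IsProbabilityMeasure (S.succLaw (historyString x)))⟩

/-- The uniform measure `μ_S`, for a tree `S` without leaves: the law of the random path that
at each string chooses a successor on `S` uniformly. -/
noncomputable def uniformMeasure (S : StringTree) : Measure (ℕ → ℕ) :=
  Kernel.trajMeasure (X := fun _ => ℕ) (S.succLaw []) S.stepKernel

instance (S : StringTree) : IsProbabilityMeasure S.uniformMeasure := by
  unfold uniformMeasure
  infer_instance

theorem measurableSet_initSeg (σ : List ℕ) (n : ℕ) : MeasurableSet {g : ℕ → ℕ | initSeg g n = σ} := by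
  have : Measurable fun g : ℕ → ℕ => fun i : Fin n => g i := by fun_prop
  have e : {g : ℕ → ℕ | initSeg g n = σ} =
      (fun g : ℕ → ℕ => fun i : Fin n => g i) ⁻¹' {x | List.ofFn x = σ} := by
    ext g
    simp [initSeg, List.ofFn_eq_map, ← List.map_coe_finRange_eq_range, Function.comp_def]
  rw [e]
  exact this (Set.to_countable _).measurableSet

theorem succLaw_singleton (S : StringTree) (σ : List ℕ) (i : ℕ) (hi : i ∈ S.succs σ) :
    S.succLaw σ {i} = ((S.succs σ).ncard : ℝ≥0∞)⁻¹ := by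
  have hf := S.finite_succs σ
  unfold succLaw
  rw [if_pos ⟨i, hi⟩, uniformOn, cond_apply hf.measurableSet,
    Set.inter_eq_right.2 (Set.singleton_subset_iff.2 hi), Measure.count_singleton, mul_one,
    Measure.count_apply_finite _ hf, Set.ncard_eq_toFinset_card _ hf]

theorem uniformMeasure_first (S : StringTree) (i : ℕ) :
    S.uniformMeasure {g | g 0 = i} = S.succLaw [] {i} := by
  have h : S.uniformMeasure.map (Preorder.frestrictLe (π := fun _ => ℕ) 0) =
      (S.succLaw []).map
        (MeasurableEquiv.piUnique (fun _ : Finset.Iic 0 => ℕ)).symm := by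
    unfold uniformMeasure Kernel.trajMeasure
    rw [Measure.map_comp _ _ (by fun_prop), Kernel.traj_map_frestrictLe,
      Kernel.partialTraj_self]
    exact Measure.id_comp
  have e : {g : ℕ → ℕ | g 0 = i} = Preorder.frestrictLe (π := fun _ => ℕ) 0 ⁻¹'
      {x | x ⟨0, by simp⟩ = i} := rfl
  have hm : MeasurableSet {x : Finset.Iic 0 → ℕ | x ⟨0, by simp⟩ = i} :=
    (Set.to_countable _).measurableSet
  rw [e, ← Measure.map_apply (by fun_prop) hm, h, Measure.map_apply (by fun_prop) hm]
  rfl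

theorem uniformMeasure_step (S : StringTree) (n : ℕ) (A : Set (Finset.Iic n → ℕ)) (i : ℕ) :
    S.uniformMeasure {g | Preorder.frestrictLe (π := fun _ => ℕ) n g ∈ A ∧ g (n + 1) = i} =
      ∫⁻ x in A, S.stepKernel n x {i}
        ∂(S.uniformMeasure.map (Preorder.frestrictLe (π := fun _ => ℕ) n)) := by
  have hA : MeasurableSet A := (Set.to_countable _).measurableSet
  have h := Kernel.map_frestrictLe_trajMeasure_compProd_eq_map_trajMeasure
    (X := fun _ => ℕ) (μ₀ := S.succLaw []) (κ := S.stepKernel) (a := n)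
  have h2 := congrArg (fun m => m (A ×ˢ {i})) h
  rw [Measure.compProd_apply_prod hA (measurableSet_singleton i),
    Measure.map_apply (by fun_prop) (hA.prod (measurableSet_singleton i))] at h2
  exact h2.symm

theorem uniformMeasure_cylinder_append (S : StringTree) (σ : List ℕ) (i : ℕ) :
    S.uniformMeasure {g | initSeg g (σ.length + 1) = σ ++ [i]} =
      S.uniformMeasure {g | initSeg g σ.length = σ} * S.succLaw σ {i} := by
  rcases hn : σ.length with _ | n
  · obtain rfl := List.length_eq_zero_iff.1 hn
    have e1 : {g : ℕ → ℕ | initSeg g (0 + 1) = [] ++ [i]} = {g | g 0 = i} := by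
      ext g
      simp [initSeg]
    have e2 : {g : ℕ → ℕ | initSeg g 0 = []} = Set.univ := by
      ext g
      simp [initSeg]
    rw [e1, e2, uniformMeasure_first, measure_univ, one_mul]
  · have hseg : ∀ g : ℕ → ℕ,
        historyString (Preorder.frestrictLe (π := fun _ => ℕ) n g) = initSeg g (n + 1) := by
      intro g
      rw [historyString, initSeg, List.ofFn_eq_map, ← List.map_coe_finRange_eq_range, List.map_map]
      rfl
    have e1 : {g : ℕ → ℕ | initSeg g (n + 1 + 1) = σ ++ [i]} =
        {g | Preorder.frestrictLe (π := fun _ => ℕ) n g ∈ {x | historyString x = σ} ∧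
          g (n + 1) = i} := by
      ext g
      simp only [Set.mem_ofPred_eq, hseg]
      have e3 : initSeg g (n + 1 + 1) = initSeg g (n + 1) ++ [g (n + 1)] := by
        simp [initSeg, List.range_succ]
      rw [e3, List.append_singleton_inj]
    have hA : MeasurableSet {x : Finset.Iic n → ℕ | historyString x = σ} :=
      (Set.to_countable _).measurableSet
    have hk : ∀ x ∈ {x : Finset.Iic n → ℕ | historyString x = σ},
        S.stepKernel n x {i} = S.succLaw σ {i} := by
      intro x hx
      change S.succLaw (historyString x) {i} = _
      rw [show historyString x = σ from hx]
    rw [e1, uniformMeasure_step, setLIntegral_congr_fun hA hk, setLIntegral_const,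
      Measure.map_apply (by fun_prop) hA, mul_comm]
    congr 2
    ext g
    simp [hseg]

/-- Each string passes its mass on to its successors in equal parts. -/
theorem uniformMeasure_cylinder_succ (S : StringTree) (σ : List ℕ) (i : ℕ)
    (hi : σ ++ [i] ∈ S.carrier) :
    S.uniformMeasure {g | initSeg g (σ.length + 1) = σ ++ [i]} =
      S.uniformMeasure {g | initSeg g σ.length = σ} / (S.succs σ).ncard := by
  rw [uniformMeasure_cylinder_append, succLaw_singleton S σ i hi, ENNReal.div_eq_inv_mul, mul_comm]

/-- If `S` has no leaves, then `[S]` has full measure. -/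
theorem uniformMeasure_ae_isPath (S : StringTree) (hS : S.NoLeaves) :
    ∀ᵐ g ∂S.uniformMeasure, S.IsPath g := by
  refine ae_all_iff.2 fun n => ?_
  induction n with
  | zero => exact Eventually.of_forall fun g => by simpa [initSeg] using S.nil_mem
  | succ n ih =>
    have key : ∀ (σ : List ℕ) (i : ℕ), σ ∈ S.carrier → σ ++ [i] ∉ S.carrier →
        ∀ᵐ g ∂S.uniformMeasure, initSeg g (σ.length + 1) ≠ σ ++ [i] := by
      intro σ i hσ hi
      have h0 : S.succLaw σ {i} = 0 := by
        have hi' : i ∉ S.succs σ := hi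
        unfold succLaw
        rw [if_pos (hS σ hσ), uniformOn, cond_apply (S.finite_succs σ).measurableSet,
          Set.inter_singleton_eq_empty.2 hi', measure_empty, mul_zero]
      have h1 := S.uniformMeasure_cylinder_append σ i
      rw [h0, mul_zero] at h1
      simpa [ae_iff] using h1
    have key2 : ∀ᵐ g ∂S.uniformMeasure, ∀ (σ : List ℕ) (i : ℕ), σ ∈ S.carrier →
        σ ++ [i] ∉ S.carrier → initSeg g (σ.length + 1) ≠ σ ++ [i] := by
      simp only [ae_all_iff, eventually_imp_distrib_left]
      exact key
    filter_upwards [ih, key2] with g h1 h2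
    by_contra h3
    have e3 : initSeg g (n + 1) = initSeg g n ++ [g n] := by
      simp [initSeg, List.range_succ]
    rw [e3] at h3
    refine h2 _ _ h1 h3 ?_
    rw [← e3]
    simp [initSeg]

end StringTree

/-- A Martin-Löf test for the uniform measure on `[S]`: a uniformly computably enumerable sequence
of sets of strings, describing open subsets `U_b = {g ∈ [S] : ∃ n, g ↾ n ∈ W_b}` of `[S]`, such
that `U_b` has measure at most `2^(-b)`. -/
structure IsMLTest (S : StringTree) (W : ℕ → Set (List ℕ)) : Prop where
  re : REPred fun p : ℕ × List ℕ => p.2 ∈ W p.1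
  measure_le : ∀ b : ℕ,
    S.uniformMeasure {g | S.IsPath g ∧ ∃ n, initSeg g n ∈ W b} ≤ (2⁻¹ : ℝ≥0∞) ^ b

/-- `f` is Martin-Löf random in `[S]` with respect to the uniform measure: it is a path on `S` that
passes every test. -/
def IsMLRandom (S : StringTree) (f : ℕ → ℕ) : Prop :=
  S.IsPath f ∧ ∀ W : ℕ → Set (List ℕ), IsMLTest S W → ∃ b, ∀ n, initSeg f n ∉ W b

/-! Let n = n(α) be the least level with |T_n| ≥ 1/α. Two paths have distance at most α exactly when
they agree on their first n entries (`dist_le_iff_initSeg`). So closed balls of radius α are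
cylinders, N_α([S]) = |S_n| (`coverNumber_pathsIn`), and C_α(f) is the least complexity of a name of
a path through f↾n. It remains to compare this complexity with log₂ |S_n|. Since |T_n| ≥ 2^n, we
have n ≤ log₂(1/α) + 1, so errors of order log n vanish after division by log₂(1/α).

Upper bound (`exists_plainComplexity_le`): f↾n is determined by n and by its rank in S_n, which
takes 2 log₂ n + log₂ |S_n| + O(1) bits. Given the string, a search finds a name of some path
through it, because the named paths are dense.

Lower bound (`isMLTest_compressible`): under level-wise uniform branching each string of S_n has
measure 1/|S_n|. At most |S_n| / (2^b (n+1)(n+2)) programs are shorter than log₂ |S_n| by b + 1 +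
log₂((n+1)(n+2)) or more, so the paths they capture at level n have measure at most 2^(-b) /
((n+1)(n+2)). Summed over n this is a Martin-Löf test. A random path escapes it, whence log₂ |S_n| ≤
C_α(f) + 2 log₂ n + O(1). -/

/-! ### Computability tools -/

section Computability

variable {α : Type*} [Primcodable α]

/-- Unbounded search: if `D` is decidable, then a partial computable function selects for each `a`
an `x` with `D a x`, if there is one. -/
theorem Partrec.exists_search {β : Type*} [Primcodable β] {D : α → β → Bool}
    (hD : Computable₂ D) :
    ∃ V : α →. β, Partrec V ∧ (∀ a, ∀ x ∈ V a, D a x = true) ∧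
      ∀ a x, D a x = true → (V a).Dom := by
  have h : Computable₂ fun (a : α) (k : ℕ) =>
      (Encodable.decode (α := β) k).bind fun x => bif D a x then Option.some x else Option.none := by
    refine Computable.option_bind (Computable.decode.comp Computable.snd) ?_
    exact Computable.cond (hD.comp (Computable.fst.comp Computable.fst) Computable.snd)
      (Computable.option_some.comp Computable.snd) (Computable.const Option.none)
  refine ⟨_, Partrec.rfindOpt h, fun a x hx => ?_, fun a x hx => Nat.rfindOpt_dom.2
    ⟨Encodable.encode x, x, by simp [hx]⟩⟩
  obtain ⟨k, hk⟩ := Nat.rfindOpt_spec hx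
  obtain ⟨y, -, hy⟩ := Option.bind_eq_some_iff.1 hk
  cases hD' : D a y <;> simp only [hD', cond_true, cond_false] at hy
  · cases hy
  · cases hy
    exact hD'

theorem REPred.exists_of_computable {β : Type*} [Primcodable β] {D : α → β → Bool}
    (hD : Computable₂ D) : REPred fun a => ∃ x, D a x = true := by
  obtain ⟨V, hV, h1, h2⟩ := Partrec.exists_search hD
  exact hV.dom_re.of_eq fun a =>
    ⟨fun h => ⟨_, h1 a _ (Part.get_mem h)⟩, fun ⟨x, hx⟩ => h2 a x hx⟩

theorem Computable.bool_and {f g : α → Bool} (hf : Computable f) (hg : Computable g) :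
    Computable fun a => f a && g a :=
  (Primrec.and.to_comp).comp hf hg

theorem Computable.decide_eq {β : Type*} [Primcodable β] [DecidableEq β] {f g : α → β}
    (hf : Computable f) (hg : Computable g) : Computable fun a => decide (f a = g a) :=
  ((Primrec.eq (α := β)).decide.to_comp).comp hf hg

theorem Computable.decide_nat_le {f g : α → ℕ}
    (hf : Computable f) (hg : Computable g) : Computable fun a => decide (f a ≤ g a) :=
  (Primrec.nat_le.decide.to_comp).comp hf hg

/-- Serves twice: it computes the rank of a string on its level, and it approximates |S_n| from
below. -/
theorem Computable.nat_count {D : α → ℕ → Bool} (hD : Computable₂ D) :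
    Computable₂ fun a k => Nat.count (fun j => D a j = true) k := by
  have h : Computable fun p : α × ℕ => Nat.rec (motive := fun _ => ℕ) 0
      (fun j ih => ih + (bif D p.1 j then 1 else 0)) p.2 := by
    refine Computable.nat_rec (f := fun p : α × ℕ => p.2) (g := fun _ => 0)
      (h := fun p q => q.2 + (bif D p.1 q.1 then 1 else 0)) Computable.snd (Computable.const 0) ?_
    have hc : Computable fun x : (α × ℕ) × ℕ × ℕ => bif D x.1.1 x.2.1 then 1 else 0 :=
      Computable.cond (hD.comp (Computable.fst.comp Computable.fst)
        (Computable.fst.comp Computable.snd)) (Computable.const 1) (Computable.const 0)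
    exact Primrec.nat_add.to_comp.comp (Computable.snd.comp Computable.snd) hc
  refine Computable.of_eq h fun p => ?_
  induction p.2 with
  | zero => simp
  | succ k ih =>
    dsimp only at ih ⊢
    rw [Nat.count_succ, ← ih]
    cases D p.1 k <;> simp

theorem computable_initSeg {g : α → ℕ → ℕ} (hg : Computable₂ g) :
    Computable₂ fun a n => initSeg (g a) n := by
  have h : Computable fun p : α × ℕ => Nat.rec (motive := fun _ => List ℕ) []
      (fun j ih => ih ++ [g p.1 j]) p.2 := by
    refine Computable.nat_rec (f := fun p : α × ℕ => p.2) (g := fun _ => [])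
      (h := fun p q => q.2 ++ [g p.1 q.1]) Computable.snd (Computable.const []) ?_
    exact Computable.list_concat.comp (Computable.snd.comp Computable.snd)
      (hg.comp (Computable.fst.comp Computable.fst) (Computable.fst.comp Computable.snd))
  refine Computable.of_eq h fun p => ?_
  induction p.2 with
  | zero => simp [initSeg]
  | succ k ih =>
    change _ ++ [g p.1 k] = _
    rw [ih]
    simp [initSeg, List.range_succ]

end Computability

/-! ### Binary strings as numbers -/

/-- The number denoted by a binary string in bijective binary notation. -/
def bitsVal : List Bool → ℕ
  | [] => 0
  | b :: l => 2 * bitsVal l + cond b 2 1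

theorem primrec_bitsVal : Primrec bitsVal := by
  have h : Primrec fun q : List Bool => List.rec (motive := fun _ => ℕ) 0
      (fun b _ ih => 2 * ih + cond b 2 1) q := by
    refine Primrec.list_rec (f := fun q : List Bool => q) (g := fun _ => 0)
      (h := fun _ p => 2 * p.2.2 + cond p.1 2 1) Primrec.id (Primrec.const _) ?_
    exact (Primrec.nat_add.comp (Primrec.nat_mul.comp (Primrec.const 2)
      (Primrec.snd.comp (Primrec.snd.comp Primrec.snd)))
      (Primrec.cond (Primrec.fst.comp Primrec.snd) (Primrec.const 2) (Primrec.const 1))).to₂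
  refine h.of_eq fun l => ?_
  induction l with
  | nil => rfl
  | cons b l ih => simp [bitsVal, ih]

theorem exists_bitsVal_eq (n : ℕ) : ∃ l, bitsVal l = n ∧ 2 ^ l.length ≤ n + 1 := by
  induction n using Nat.strong_induction_on with
  | _ n ih =>
    rcases n with _ | m
    · exact ⟨[], rfl, by simp⟩
    · obtain ⟨l, h1, h2⟩ := ih (m / 2) (by omega)
      -- The least significant digit comes first: m + 1 = 2 * (m / 2) + 1 + m % 2, so the digit is 2
      -- for odd m and 1 for even m.
      refine ⟨decide (m % 2 = 1) :: l, ?_, ?_⟩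
      · rcases Nat.mod_two_eq_zero_or_one m with h | h <;> simp [bitsVal, h1, h] <;> omega
      · rw [List.length_cons, pow_succ]; omega

theorem bitsVal_injective : Function.Injective bitsVal := by
  intro l
  induction l with
  | nil =>
    rintro (_ | ⟨b, m⟩) h
    · rfl
    · cases b <;> simp [bitsVal] at h
  | cons a l ih =>
    rintro (_ | ⟨b, m⟩) h
    · cases a <;> simp [bitsVal] at h
    · cases a <;> cases b <;> simp only [bitsVal, cond_true, cond_false] at h
      · rw [ih (show bitsVal l = bitsVal m by omega)]
      · omega
      · omega
      · rw [ih (show bitsVal l = bitsVal m by omega)]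

/-- Together with injectivity this bounds the number of programs up to a given length. -/
theorem bitsVal_add_two_le (l : List Bool) : bitsVal l + 2 ≤ 2 ^ (l.length + 1) := by
  induction l with
  | nil => simp [bitsVal]
  | cons b l ih =>
    rw [List.length_cons, pow_succ]
    cases b <;> simp only [bitsVal, cond_true, cond_false] <;> omega

/-- The code of a pair of binary strings in which the first is self-delimiting. -/
def pairBits (l m : List Bool) : List Bool :=
  List.replicate l.length false ++ true :: (l ++ m)

/-- The first component of the pair coded by a string. -/
def unpairBitsFst (p : List Bool) : List Bool :=
  ((p.dropWhile fun b => !b).tail).take (p.takeWhile fun b => !b).length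

/-- The second component of the pair coded by a string. -/
def unpairBitsSnd (p : List Bool) : List Bool :=
  ((p.dropWhile fun b => !b).tail).drop (p.takeWhile fun b => !b).length

theorem takeWhile_pairBits (l m : List Bool) :
    ((pairBits l m).takeWhile fun b => !b).length = l.length := by
  rw [pairBits, List.takeWhile_append_of_pos (by simp)]; simp

theorem dropWhile_pairBits (l m : List Bool) :
    ((pairBits l m).dropWhile fun b => !b).tail = l ++ m := by
  rw [pairBits, List.dropWhile_append_of_pos (by simp)]; simp

@[simp]
theorem unpairBitsFst_pairBits (l m : List Bool) : unpairBitsFst (pairBits l m) = l := by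
  rw [unpairBitsFst, takeWhile_pairBits, dropWhile_pairBits, List.take_left]

@[simp]
theorem unpairBitsSnd_pairBits (l m : List Bool) : unpairBitsSnd (pairBits l m) = m := by
  rw [unpairBitsSnd, takeWhile_pairBits, dropWhile_pairBits, List.drop_left]

/-- Only the first component is paid for twice. It will hold the length n, of logarithmic size,
while the rank in the second component keeps the coefficient 1. -/
theorem length_pairBits (l m : List Bool) :
    (pairBits l m).length = 2 * l.length + m.length + 1 := by
  simp [pairBits]; omega

theorem primrec_unpairBits_aux :
    Primrec (fun p : List Bool => (p.takeWhile fun b => !b).length) ∧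
      Primrec fun p : List Bool => (p.dropWhile fun b => !b).tail :=
  ⟨Primrec.list_length.comp (Primrec.list_takeWhile Primrec.not),
    Primrec.list_tail.comp (Primrec.list_dropWhile Primrec.not)⟩

theorem primrec_unpairBitsFst : Primrec unpairBitsFst :=
  Primrec.list_take.comp primrec_unpairBits_aux.1 primrec_unpairBits_aux.2

theorem primrec_unpairBitsSnd : Primrec unpairBitsSnd :=
  Primrec.list_drop.comp primrec_unpairBits_aux.1 primrec_unpairBits_aux.2

/-! ### Programs and names -/

theorem plainComplexity_le_length {q u : List Bool} (h : u ∈ universalMachine q) :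
    plainComplexity u ≤ q.length :=
  Nat.sInf_le ⟨q, h, rfl⟩

theorem exists_program (u : List Bool) :
    ∃ q, u ∈ universalMachine q ∧ q.length = plainComplexity u := by
  -- Optimality against the identity machine shows that `u` has a description at all, so the infimum
  -- is attained and is not the default value 0 of the empty set.
  obtain ⟨c, hc⟩ := universalMachine_optimal (fun p => Part.some p) Computable.id.partrec
  obtain ⟨q, hq, -⟩ := hc u u (Part.mem_some u)
  exact Nat.sInf_mem (s := {k | ∃ q : List Bool, u ∈ universalMachine q ∧ q.length = k})
    ⟨_, q, hq, rfl⟩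

theorem complexityAtPrecision_le {M : Type*} [MetricSpace M] {r : List Bool → M} {x : M} {α : ℝ}
    {u : List Bool} (h : dist x (r u) ≤ α) : complexityAtPrecision r x α ≤ plainComplexity u :=
  (Nat.sInf_le (s := {k | ∃ w ∈ Set.range r, dist x w ≤ α ∧ nameComplexity r w = k})
    ⟨r u, ⟨u, rfl⟩, h, rfl⟩).trans
    (Nat.sInf_le (s := {k | ∃ v, r v = r u ∧ plainComplexity v = k}) ⟨u, rfl, rfl⟩)

/-- Density makes the outer set of values nonempty, so both nested infima are attained. -/
theorem exists_complexityAtPrecision_eq {M : Type*} [MetricSpace M] {r : List Bool → M}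
    (hr : DenseRange r) (x : M) {α : ℝ} (hα : 0 < α) :
    ∃ u, dist x (r u) ≤ α ∧ plainComplexity u = complexityAtPrecision r x α := by
  obtain ⟨v, hv⟩ := hr.exists_dist_lt x hα
  obtain ⟨w, ⟨u0, hu0⟩, h1, h2⟩ := Nat.sInf_mem
    (s := {k | ∃ w ∈ Set.range r, dist x w ≤ α ∧ nameComplexity r w = k})
    ⟨_, r v, ⟨v, rfl⟩, hv.le, rfl⟩
  obtain ⟨u, h3, h4⟩ := Nat.sInf_mem (s := {k | ∃ u, r u = w ∧ plainComplexity u = k})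
    ⟨_, u0, hu0, rfl⟩
  exact ⟨u, h3 ▸ h1, h4.trans h2⟩

/-- Halting becomes the existence of a running time and an output with a decidable property, which
makes the later test enumerable. -/
theorem mem_universalMachine_iff {q u : List Bool} :
    u ∈ universalMachine q ↔ ∃ t m, Nat.Partrec.Code.evaln t
      (Denumerable.ofNat Nat.Partrec.Code (q.takeWhile (fun b => !b)).length)
      (Encodable.encode (q.dropWhile (fun b => !b)).tail) = some m ∧
      (Encodable.decode m : Option (List Bool)) = some u := by
  unfold universalMachine
  simp only [Part.mem_bind_iff, Nat.Partrec.Code.evaln_complete, Option.mem_def, Part.mem_coe]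
  exact ⟨fun ⟨m, ⟨t, ht⟩, hm⟩ => ⟨t, m, ht, hm⟩, fun ⟨t, m, ht, hm⟩ => ⟨m, ⟨t, ht⟩, hm⟩⟩

/-! ### Levels of trees -/

theorem initSeg_eq_initSeg_iff {f g : ℕ → ℕ} {n : ℕ} :
    initSeg f n = initSeg g n ↔ ∀ i < n, f i = g i := by
  simp [initSeg]

theorem length_initSeg (f : ℕ → ℕ) (n : ℕ) : (initSeg f n).length = n := by
  simp [initSeg]

namespace StringTree

theorem initSeg_mem_level {S : StringTree} {f : ℕ → ℕ} (hf : S.IsPath f) (n : ℕ) :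
    initSeg f n ∈ S.level n :=
  ⟨hf n, length_initSeg f n⟩

theorem ncard_level_zero (S : StringTree) : (S.level 0).ncard = 1 := by
  have : S.level 0 = {[]} := by
    ext σ
    simp only [level, List.length_eq_zero_iff, Set.mem_ofPred_eq, Set.mem_singleton_iff]
    exact ⟨fun h => h.2, fun h => ⟨h ▸ S.nil_mem, h⟩⟩
  rw [this, Set.ncard_singleton]

theorem ncard_level_succ (S : StringTree) (n : ℕ) :
    (S.level (n + 1)).ncard = ∑ σ ∈ (S.finite_level n).toFinset, (S.succs σ).ncard := by
  classical
  rw [Set.ncard_eq_toFinset_card _ (S.finite_level (n + 1)),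
    Finset.card_eq_sum_card_fiberwise (f := List.dropLast) (t := (S.finite_level n).toFinset)]
  · refine Finset.sum_congr rfl fun σ hσ => ?_
    have hσ' : σ ∈ S.level n := by simpa using hσ
    rw [← Set.ncard_image_of_injective (S.succs σ) (f := fun i => σ ++ [i])
      (fun i j h => by simpa using h), ← Set.ncard_coe_finset]
    congr 1
    ext τ
    simp only [Finset.coe_filter, Set.Finite.mem_toFinset, Set.mem_ofPred_eq, Set.mem_image]
    constructor
    · rintro ⟨⟨h1, h2⟩, rfl⟩
      have hne : τ ≠ [] := by
        rintro rfl
        simp at h2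
      refine ⟨τ.getLast hne, ?_, List.dropLast_append_getLast hne⟩
      change τ.dropLast ++ [τ.getLast hne] ∈ S.carrier
      rwa [List.dropLast_append_getLast hne]
    · rintro ⟨i, hi, rfl⟩
      exact ⟨⟨hi, by simp [hσ'.2]⟩, by simp⟩
  · intro τ hτ
    have hτ' : τ ∈ S.level (n + 1) := by simpa using hτ
    have h : τ.dropLast ∈ S.level n :=
      ⟨S.prefix_closed _ _ (List.dropLast_prefix τ) hτ'.1, by simp [hτ'.2]⟩
    simpa using h

theorem ncard_level_succ_of_forall (S : StringTree) {n b : ℕ}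
    (h : ∀ σ ∈ S.level n, (S.succs σ).ncard = b) :
    (S.level (n + 1)).ncard = (S.level n).ncard * b := by
  rw [ncard_level_succ, Finset.sum_const_nat fun σ hσ => h σ (by simpa using hσ),
    Set.ncard_eq_toFinset_card _ (S.finite_level n)]

theorem ncard_level_mul_le (T : StringTree) {b : ℕ} (h : ∀ σ ∈ T.carrier, b ≤ (T.succs σ).ncard)
    (n : ℕ) : (T.level n).ncard * b ≤ (T.level (n + 1)).ncard := by
  rw [ncard_level_succ, Set.ncard_eq_toFinset_card _ (T.finite_level n), ← smul_eq_mul]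
  exact Finset.card_nsmul_le_sum _ _ _ fun σ hσ =>
    h σ (show σ ∈ T.level n by simpa using hσ).1

section Branching

variable {T : StringTree} (hT2 : ∀ σ ∈ T.carrier, 2 ≤ (T.succs σ).ncard)
include hT2

theorem two_pow_le_ncard_level (n : ℕ) : 2 ^ n ≤ (T.level n).ncard := by
  induction n with
  | zero => rw [ncard_level_zero, pow_zero]
  | succ n ih => exact (Nat.mul_le_mul_right 2 ih).trans (T.ncard_level_mul_le hT2 n)

theorem ncard_level_pos (n : ℕ) : 0 < (T.level n).ncard :=
  (Nat.two_pow_pos n).trans_le (two_pow_le_ncard_level hT2 n)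

theorem monotone_ncard_level : Monotone fun n => (T.level n).ncard :=
  monotone_nat_of_le_succ fun n => by
    have := T.ncard_level_mul_le hT2 n
    omega

end Branching

theorem uniformMeasure_cylinder_ne_zero (S : StringTree) {σ : List ℕ} (hσ : σ ∈ S.carrier) :
    S.uniformMeasure {g | initSeg g σ.length = σ} ≠ 0 := by
  induction σ using List.reverseRecOn with
  | nil => simp [initSeg]
  | append_singleton σ i ih =>
    rw [List.length_append, List.length_singleton, uniformMeasure_cylinder_succ S σ i hσ]
    exact ENNReal.div_ne_zero.2
      ⟨ih (S.prefix_closed _ _ (List.prefix_append _ _) hσ), ENNReal.natCast_ne_top _⟩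

/-- The cylinder of `σ` has positive measure and almost every sequence is a path, so the cylinder
contains a path. -/
theorem exists_isPath_initSeg_eq {S : StringTree} (hS : S.NoLeaves) {σ : List ℕ}
    (hσ : σ ∈ S.carrier) : ∃ f, S.IsPath f ∧ initSeg f σ.length = σ := by
  by_contra! h
  refine S.uniformMeasure_cylinder_ne_zero hσ (measure_mono_null (fun g hg => ?_)
    (ae_iff.1 (S.uniformMeasure_ae_isPath hS)))
  exact fun hp => h g hp hg

/-- Passing to the next level divides the mass of a string by the common number of successors and
multiplies the size of the level by the same number. -/
theorem uniformMeasure_cylinder_eq {S : StringTree} (hu : S.LevelwiseUniformlyBranching)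
    (hS : S.NoLeaves) {σ : List ℕ} (hσ : σ ∈ S.carrier) :
    S.uniformMeasure {g | initSeg g σ.length = σ} = ((S.level σ.length).ncard : ℝ≥0∞)⁻¹ := by
  induction σ using List.reverseRecOn with
  | nil => simp [initSeg, ncard_level_zero]
  | append_singleton σ i ih =>
    have hσ' := S.prefix_closed _ _ (List.prefix_append _ _) hσ
    have hb : (S.succs σ).ncard ≠ 0 :=
      ((Set.ncard_pos (S.finite_succs σ)).2 (hS σ hσ')).ne'
    rw [List.length_append, List.length_singleton, uniformMeasure_cylinder_succ S σ i hσ,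
      ih hσ', S.ncard_level_succ_of_forall (b := (S.succs σ).ncard)
        fun τ hτ => hu τ hτ.1 σ hσ' hτ.2, Nat.cast_mul,
      ENNReal.mul_inv (Or.inr (ENNReal.natCast_ne_top _)) (Or.inl (ENNReal.natCast_ne_top _)),
      ENNReal.div_eq_inv_mul, mul_comm]

/-! ### Balls and coverings in the path space -/

/-- The least level with at least `1 / α` strings. -/
noncomputable def precisionLevel (T : StringTree) (α : ℝ) : ℕ :=
  sInf {n | α⁻¹ ≤ ((T.level n).ncard : ℝ)}

theorem dist_le_iff_forall {T : StringTree} {f g : T.Path} {α : ℝ} (hα : 0 ≤ α) :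
    dist f g ≤ α ↔ ∀ n, f.1 n ≠ g.1 n → ((T.level n).ncard : ℝ)⁻¹ ≤ α := by
  constructor
  · intro h n hn
    have h1 := le_ciSup (T.bddAbove_pathDist f g) n
    simp only [if_neg hn] at h1
    exact h1.trans h
  · intro h
    refine ciSup_le fun n => ?_
    split_ifs with hn
    exacts [hα, h n hn]

section Branching

variable {T : StringTree} (hT2 : ∀ σ ∈ T.carrier, 2 ≤ (T.succs σ).ncard)
include hT2

/-- The level sizes are monotone and unbounded, so the levels with at least 1/α strings form a
nonempty final segment of ℕ. -/
theorem precisionLevel_le_iff {α : ℝ} {n : ℕ} :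
    T.precisionLevel α ≤ n ↔ α⁻¹ ≤ ((T.level n).ncard : ℝ) := by
  constructor
  · intro h
    obtain ⟨m, hm⟩ := pow_unbounded_of_one_lt α⁻¹ one_lt_two
    have h1 : α⁻¹ ≤ ((T.level (T.precisionLevel α)).ncard : ℝ) :=
      Nat.sInf_mem (s := {n | α⁻¹ ≤ ((T.level n).ncard : ℝ)})
        ⟨m, hm.le.trans (by exact_mod_cast two_pow_le_ncard_level hT2 m)⟩
    exact h1.trans (by exact_mod_cast monotone_ncard_level hT2 h)
  · exact fun h => Nat.sInf_le h

theorem dist_le_iff_initSeg {f g : T.Path} {α : ℝ} (hα : 0 < α) :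
    dist f g ≤ α ↔ initSeg f.1 (T.precisionLevel α) = initSeg g.1 (T.precisionLevel α) := by
  rw [dist_le_iff_forall hα.le, initSeg_eq_initSeg_iff]
  have key : ∀ n, ((T.level n).ncard : ℝ)⁻¹ ≤ α ↔ T.precisionLevel α ≤ n := fun n => by
    rw [precisionLevel_le_iff hT2, inv_le_comm₀ (by exact_mod_cast ncard_level_pos hT2 n) hα]
  simp only [key]
  exact forall_congr' fun n =>
    ⟨fun h hn => by_contra fun h' => absurd (h h') (by omega), fun h hn => by
      by_contra h'
      exact hn (h (by omega))⟩

/-- The level m just before the precision level has at least 2^m but fewer than 1/α strings. -/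
theorem precisionLevel_le_logb {α : ℝ} (hα : 0 < α) (hα1 : α ≤ 1) :
    (T.precisionLevel α : ℝ) ≤ Real.logb 2 (1 / α) + 1 := by
  have h0 : 0 ≤ Real.logb 2 (1 / α) :=
    Real.logb_nonneg one_lt_two (by rw [one_div]; exact one_le_inv_iff₀.2 ⟨hα, hα1⟩)
  rcases h : T.precisionLevel α with _ | m
  · push_cast; linarith
  · have h1 : ((T.level m).ncard : ℝ) < α⁻¹ := by
      rw [← not_le, ← precisionLevel_le_iff hT2]; omega
    have h2 : (2 : ℝ) ^ m ≤ ((T.level m).ncard : ℝ) := by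
      exact_mod_cast two_pow_le_ncard_level hT2 m
    have h3 : (m : ℝ) ≤ Real.logb 2 (1 / α) := by
      rw [Real.le_logb_iff_rpow_le one_lt_two (by positivity), Real.rpow_natCast, one_div]
      exact h2.trans h1.le
    push_cast; linarith

/-- A name closer to `f` than 1/|T_n| works: a disagreement at some i < n would force |T_n| < |T_i|,
against monotonicity. -/
theorem exists_initSeg_eq_of_dense {r : List Bool → T.Path} (hr : DenseRange r) (f : T.Path)
    (n : ℕ) : ∃ u, initSeg (r u).1 n = initSeg f.1 n := by
  have hp : (0 : ℝ) < ((T.level n).ncard : ℝ) := by exact_mod_cast ncard_level_pos hT2 n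
  obtain ⟨u, hu⟩ := hr.exists_dist_lt f (inv_pos.2 hp)
  refine ⟨u, initSeg_eq_initSeg_iff.2 fun i hi => ?_⟩
  by_contra hne
  have h1 := (dist_le_iff_forall dist_nonneg).1 (le_refl (dist f (r u))) i (Ne.symm hne)
  have h2 := (inv_lt_inv₀ (by exact_mod_cast ncard_level_pos hT2 i) hp).1 (h1.trans_lt hu)
  have h3 : (T.level i).ncard ≤ (T.level n).ncard := monotone_ncard_level hT2 hi.le
  exact absurd h2 (not_lt.2 (by exact_mod_cast h3))

/-- The cylinders of the strings in S_n form a covering. Conversely, choose a path of S through each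
string of S_n: distinct choices are more than α apart, so they lie in distinct members of any
covering. -/
theorem coverNumber_pathsIn {S : StringTree} (hST : S.carrier ⊆ T.carrier) (hS : S.NoLeaves)
    {α : ℝ} (hα : 0 < α) :
    coverNumber (S.pathsIn T) α = ((S.level (T.precisionLevel α)).ncard : ℕ∞) := by
  set n := T.precisionLevel α
  rw [(S.finite_level n).cast_ncard_eq]
  refine le_antisymm ?_ (le_iInf₂ fun 𝒰 h𝒰 => ?_)
  · refine (iInf₂_le ((fun σ => {g : T.Path | initSeg g.1 n = σ}) '' S.level n)
      ⟨fun f hf => ?_, ?_⟩).trans (Set.encard_image_le _ _)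
    · exact ⟨_, ⟨_, initSeg_mem_level hf n, rfl⟩, rfl⟩
    · rintro _ ⟨σ, -, rfl⟩
      refine Metric.ediam_le fun f hf g hg => ?_
      rw [edist_dist]
      exact ENNReal.ofReal_le_ofReal
        ((dist_le_iff_initSeg hT2 hα).2 (Eq.trans hf (Eq.symm hg)))
  · have hex : ∀ σ : S.level n, ∃ f : T.Path, f ∈ S.pathsIn T ∧ initSeg f.1 n = σ.1 := by
      rintro ⟨σ, hσ, hn⟩
      obtain ⟨f, hf, he⟩ := exists_isPath_initSeg_eq hS hσ
      rw [hn] at he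
      exact ⟨⟨f, fun k => hST (hf k)⟩, hf, he⟩
    choose F hF hFσ using hex
    have hU : ∀ σ : S.level n, ∃ U ∈ 𝒰, F σ ∈ U := fun σ => h𝒰.1 (hF σ)
    choose U hU hFU using hU
    have hinj : Function.Injective fun σ : S.level n => (⟨U σ, hU σ⟩ : 𝒰) := by
      intro σ τ h
      have h1 : U σ = U τ := congrArg Subtype.val h
      have h2 := (Metric.edist_le_ediam_of_mem (hFU σ) (h1 ▸ hFU τ)).trans (h𝒰.2 _ (hU σ))
      rw [edist_dist, ENNReal.ofReal_le_ofReal_iff hα.le, dist_le_iff_initSeg hT2 hα] at h2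
      exact Subtype.ext (by rw [← hFσ σ, ← hFσ τ]; exact h2)
    exact Function.Embedding.encard_le ⟨_, hinj⟩

end Branching

end StringTree

namespace StringTree

/-! ### Enumerating the levels of a decidable tree -/

/-- Decides whether the string coded by `j` is of length `n` and accepted by `d`. -/
def levelTest (d : List ℕ → Bool) (n j : ℕ) : Bool :=
  d (Denumerable.ofNat (List ℕ) j) && decide ((Denumerable.ofNat (List ℕ) j).length = n)

theorem computable_levelTest {d : List ℕ → Bool} (hd : Computable d) :
    Computable₂ (levelTest d) := by
  have h : Computable fun p : ℕ × ℕ => Denumerable.ofNat (List ℕ) p.2 :=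
    (Computable.ofNat _).comp Computable.snd
  exact Computable.bool_and (hd.comp h)
    (Computable.decide_eq (Computable.list_length.comp h) Computable.fst)

section LevelTest

variable {S : StringTree} {d : List ℕ → Bool} (hd : ∀ σ, d σ = true ↔ σ ∈ S.carrier)
include hd

theorem levelTest_iff {n j : ℕ} :
    levelTest d n j = true ↔ Denumerable.ofNat (List ℕ) j ∈ S.level n := by
  simp only [levelTest, Bool.and_eq_true, hd, decide_eq_true_eq, level, Set.mem_ofPred_eq]

theorem setOf_levelTest (n : ℕ) :
    (Set.ofPred fun j => levelTest d n j = true) = Encodable.encode '' S.level n := by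
  ext j
  rw [Set.mem_ofPred_eq, levelTest_iff hd, Set.mem_image]
  exact ⟨fun h => ⟨_, h, Denumerable.encode_ofNat j⟩,
    fun ⟨σ, h, he⟩ => by rwa [← he, Denumerable.ofNat_encode]⟩

theorem finite_levelTest (n : ℕ) : (Set.ofPred fun j => levelTest d n j = true).Finite := by
  rw [setOf_levelTest hd]
  exact (S.finite_level n).image _

theorem card_levelTest (n : ℕ) : (finite_levelTest hd n).toFinset.card = (S.level n).ncard := by
  rw [← Set.ncard_eq_toFinset_card _ (finite_levelTest hd n), setOf_levelTest hd,
    Set.ncard_image_of_injective _ Encodable.encode_injective]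

theorem count_levelTest_lt {n j : ℕ} (h : levelTest d n j = true) :
    Nat.count (fun i => levelTest d n i = true) j < (S.level n).ncard := by
  rw [← card_levelTest hd n]
  exact Nat.count_lt_card _ h

theorem count_levelTest_le (n k : ℕ) :
    Nat.count (fun i => levelTest d n i = true) k ≤ (S.level n).ncard := by
  rw [← card_levelTest hd n]
  exact Nat.count_le_card _ k

/-- Nothing bounds the labels on a level computably, so |S_n| is only approximated from below. The
counts never exceed it and eventually reach it, so a lower bound on |S_n| can be verified at a
finite stage. -/
theorem exists_count_levelTest_eq (n : ℕ) :
    ∃ k, Nat.count (fun i => levelTest d n i = true) k = (S.level n).ncard := by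
  obtain ⟨k, hk⟩ := (finite_levelTest hd n).bddAbove
  refine ⟨k + 1, ?_⟩
  rw [← card_levelTest hd n, Nat.count_eq_card_filter_range]
  congr 1
  ext j
  simp only [Finset.mem_filter, Finset.mem_range, Set.Finite.mem_toFinset]
  exact ⟨fun h => h.2, fun h => ⟨Nat.lt_succ_of_le (hk h), h⟩⟩

end LevelTest

theorem IsComputable.exists_decider {S : StringTree} (hS : S.IsComputable) :
    ∃ d : List ℕ → Bool, Computable d ∧ ∀ σ, d σ = true ↔ σ ∈ S.carrier := by
  obtain ⟨d, hd, he⟩ := ComputablePred.computable_iff.1 hS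
  exact ⟨d, hd, fun σ => iff_of_eq (congrFun he σ).symm⟩

/-! ### Initial segments of paths have short names -/

/-- Decides whether the pair `x = (j, u)` consists of the code `j` of the string of `S` described by
`p` (by its length and its position on its level), and of a name `u` of a path through it. -/
def nameTest (d : List ℕ → Bool) (r : List Bool → ℕ → ℕ) (p : List Bool) (x : ℕ × List Bool) :
    Bool :=
  (levelTest d (bitsVal (unpairBitsFst p)) x.1 &&
    decide (Nat.count (fun i => levelTest d (bitsVal (unpairBitsFst p)) i = true) x.1 =
      bitsVal (unpairBitsSnd p))) &&
    decide (initSeg (r x.2) (bitsVal (unpairBitsFst p)) = Denumerable.ofNat (List ℕ) x.1)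

theorem computable_nameTest {d : List ℕ → Bool} (hd : Computable d) {r : List Bool → ℕ → ℕ}
    (hr : Computable₂ r) : Computable₂ (nameTest d r) := by
  have h1 : Computable fun y : List Bool × ℕ × List Bool => bitsVal (unpairBitsFst y.1) :=
    (primrec_bitsVal.comp primrec_unpairBitsFst).to_comp.comp Computable.fst
  have h2 : Computable fun y : List Bool × ℕ × List Bool => bitsVal (unpairBitsSnd y.1) :=
    (primrec_bitsVal.comp primrec_unpairBitsSnd).to_comp.comp Computable.fst
  have h3 : Computable fun y : List Bool × ℕ × List Bool => y.2.1 :=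
    Computable.fst.comp Computable.snd
  have h4 : Computable fun y : List Bool × ℕ × List Bool => y.2.2 :=
    Computable.snd.comp Computable.snd
  exact Computable.bool_and
    (Computable.bool_and ((computable_levelTest hd).comp h1 h3)
      (Computable.decide_eq
        ((Computable.nat_count (computable_levelTest hd)).comp h1 h3) h2))
    (Computable.decide_eq ((computable_initSeg hr).comp h4 h1) ((Computable.ofNat _).comp h3))

/-- A machine reads n and a rank, finds the string of S_n with this rank, and searches for a name of
a path through it. The name found need not be one fixed in advance; it only has to share the initial
segment of length n. -/
theorem exists_plainComplexity_le {T S : StringTree}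
    (hT2 : ∀ σ ∈ T.carrier, 2 ≤ (T.succs σ).ncard) {r : List Bool → T.Path}
    (hr : T.IsComputableStructure r) (hS : S.IsComputable) :
    ∃ c : ℕ, ∀ f ∈ S.pathsIn T, ∀ n, ∃ u, initSeg (r u).1 n = initSeg f.1 n ∧
      ∃ a b : ℕ, plainComplexity u ≤ 2 * a + b + c ∧ 2 ^ a ≤ n + 1 ∧
        2 ^ b ≤ (S.level n).ncard := by
  obtain ⟨d, hdc, hd⟩ := hS.exists_decider
  have hrc : Computable₂ fun (u : List Bool) (n : ℕ) => (r u).1 n := hr.computable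
  obtain ⟨V, hV, hV1, hV2⟩ := Partrec.exists_search (computable_nameTest hdc hrc)
  obtain ⟨c, hc⟩ := universalMachine_optimal (fun p => (V p).map Prod.snd)
    (hV.map (Computable.snd.comp Computable.snd).to₂)
  -- The additional 1 is the delimiter bit of the coded pair.
  refine ⟨c + 1, fun f hf n => ?_⟩
  set j := Encodable.encode (initSeg f.1 n)
  have hj : levelTest d n j = true := by
    rw [levelTest_iff hd, Denumerable.ofNat_encode]
    exact initSeg_mem_level hf n
  obtain ⟨l, hl, hl2⟩ := exists_bitsVal_eq n
  obtain ⟨m, hm, hm2⟩ := exists_bitsVal_eq (Nat.count (fun i => levelTest d n i = true) j)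
  obtain ⟨u, hu⟩ := exists_initSeg_eq_of_dense hT2 hr.dense f n
  -- The pair `(j, u)` only witnesses that the search halts; its result `x` may be another pair.
  obtain ⟨x, hx⟩ := Part.dom_iff_mem.1 (hV2 (pairBits l m) (j, u)
    (by simp [nameTest, hl, hm, hj, hu, j]))
  have hEx := hV1 _ _ hx
  obtain ⟨q, hq, hql⟩ := hc (pairBits l m) x.2 (Part.mem_map Prod.snd hx)
  refine ⟨x.2, ?_, l.length, m.length, ?_, hl2, ?_⟩
  · simp only [nameTest, unpairBitsFst_pairBits, unpairBitsSnd_pairBits, hl, hm,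
      Bool.and_eq_true, decide_eq_true_eq] at hEx
    rw [hEx.2, Nat.count_injective hEx.1.1 hj hEx.1.2, Denumerable.ofNat_encode]
  · have := plainComplexity_le_length hq
    rw [length_pairBits] at hql
    omega
  -- Ranks start at 0, so the rank plus 1 is at most |S_n|.
  · exact hm2.trans (count_levelTest_lt hd hj)

/-! ### Initial segments of random paths have no short names -/

/-- The strings of length `n` that are initial segments of paths whose names have a program shorter
than `log₂ |S_n|` by `b + 1 + log₂ ((n + 1) * (n + 2))`. -/
def compressible (S : StringTree) (r : List Bool → ℕ → ℕ) (b : ℕ) : Set (List ℕ) :=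
  {σ | ∃ q u, u ∈ universalMachine q ∧ initSeg (r u) σ.length = σ ∧
    2 ^ (q.length + b + 1) * ((σ.length + 1) * (σ.length + 2)) ≤ (S.level σ.length).ncard}

theorem rePred_compressible {S : StringTree} (hS : S.IsComputable) {r : List Bool → ℕ → ℕ}
    (hr : Computable₂ r) : REPred fun p : ℕ × List ℕ => p.2 ∈ S.compressible r p.1 := by
  obtain ⟨d, hdc, hd⟩ := hS.exists_decider
  -- The witness is `((q, u), t, m, k)`: a program, its output, a running time, the code of the
  -- output, and a stage k at which enough strings of the level have been counted.
  let D : ℕ × List ℕ → (List Bool × List Bool) × ℕ × ℕ × ℕ → Bool := fun p x =>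
    ((decide (Nat.Partrec.Code.evaln x.2.1
      (Denumerable.ofNat Nat.Partrec.Code (x.1.1.takeWhile (fun b => !b)).length)
      (Encodable.encode (x.1.1.dropWhile (fun b => !b)).tail) = some x.2.2.1) &&
      decide ((Encodable.decode x.2.2.1 : Option (List Bool)) = some x.1.2)) &&
      decide (initSeg (r x.1.2) p.2.length = p.2)) &&
      decide (2 ^ (x.1.1.length + p.1 + 1) * ((p.2.length + 1) * (p.2.length + 2)) ≤
        Nat.count (fun i => levelTest d p.2.length i = true) x.2.2.2)
  have hD : Computable₂ D := by
    have hq : Computable fun y : (ℕ × List ℕ) × (List Bool × List Bool) × ℕ × ℕ × ℕ => y.2.1.1 :=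
      Computable.fst.comp (Computable.fst.comp Computable.snd)
    have hu : Computable fun y : (ℕ × List ℕ) × (List Bool × List Bool) × ℕ × ℕ × ℕ => y.2.1.2 :=
      Computable.snd.comp (Computable.fst.comp Computable.snd)
    have ht : Computable fun y : (ℕ × List ℕ) × (List Bool × List Bool) × ℕ × ℕ × ℕ => y.2.2.1 :=
      Computable.fst.comp (Computable.snd.comp Computable.snd)
    have hm : Computable fun y : (ℕ × List ℕ) × (List Bool × List Bool) × ℕ × ℕ × ℕ => y.2.2.2.1 :=
      Computable.fst.comp (Computable.snd.comp (Computable.snd.comp Computable.snd))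
    have hN : Computable fun y : (ℕ × List ℕ) × (List Bool × List Bool) × ℕ × ℕ × ℕ => y.2.2.2.2 :=
      Computable.snd.comp (Computable.snd.comp (Computable.snd.comp Computable.snd))
    have hb : Computable fun y : (ℕ × List ℕ) × (List Bool × List Bool) × ℕ × ℕ × ℕ => y.1.1 :=
      Computable.fst.comp Computable.fst
    have hσ : Computable fun y : (ℕ × List ℕ) × (List Bool × List Bool) × ℕ × ℕ × ℕ => y.1.2 :=
      Computable.snd.comp Computable.fst
    have hn := Computable.list_length.comp hσ
    have add {f g : (ℕ × List ℕ) × (List Bool × List Bool) × ℕ × ℕ × ℕ → ℕ} (hf : Computable f)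
        (hg : Computable g) : Computable fun y => f y + g y := Primrec.nat_add.to_comp.comp hf hg
    have mul {f g : (ℕ × List ℕ) × (List Bool × List Bool) × ℕ × ℕ × ℕ → ℕ} (hf : Computable f)
        (hg : Computable g) : Computable fun y => f y * g y := Primrec.nat_mul.to_comp.comp hf hg
    have pow : Computable fun k : ℕ => 2 ^ k :=
      (Primrec₂.unpaired'.1 Nat.Primrec.pow).to_comp.comp (Computable.const 2) Computable.id
    exact Computable.bool_and
      (Computable.bool_and
        (Computable.bool_and
          (Computable.decide_eq
            (Nat.Partrec.Code.primrec_evaln.to_comp.comp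
              ((ht.pair ((Computable.ofNat _).comp (primrec_unpairBits_aux.1.to_comp.comp hq))).pair
                (Computable.encode.comp (primrec_unpairBits_aux.2.to_comp.comp hq))))
            (Computable.option_some.comp hm))
          (Computable.decide_eq (Computable.decode.comp hm) (Computable.option_some.comp hu)))
        (Computable.decide_eq ((computable_initSeg hr).comp hu hn) hσ))
      (Computable.decide_nat_le
        (mul (pow.comp (add (add (Computable.list_length.comp hq) hb) (Computable.const 1)))
          (mul (add hn (Computable.const 1)) (add hn (Computable.const 2))))
        ((Computable.nat_count (computable_levelTest hdc)).comp hn hN))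
  refine (REPred.exists_of_computable hD).of_eq fun p => ?_
  simp only [D, Bool.and_eq_true, decide_eq_true_eq, compressible, Set.mem_ofPred_eq,
    mem_universalMachine_iff]
  constructor
  · rintro ⟨x, ⟨h1, h2⟩, h3⟩
    exact ⟨_, _, ⟨_, _, h1⟩, h2, h3.trans (count_levelTest_le hd _ _)⟩
  · rintro ⟨q, u, ⟨t, m, h1⟩, h2, h3⟩
    obtain ⟨k, hk⟩ := exists_count_levelTest_eq hd p.2.length
    exact ⟨((q, u), t, m, k), ⟨h1, h2⟩, h3.trans hk.ge⟩

/-- The sum telescopes. These weights distribute the measure 2^(-b) over the levels at a cost of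
only O(log n) bits. -/
theorem _root_.ENNReal.tsum_inv_succ_mul_succ_succ_le :
    ∑' n : ℕ, (((n + 1) * (n + 2) : ℕ) : ℝ≥0∞)⁻¹ ≤ 1 := by
  refine ENNReal.tsum_le_of_sum_range_le fun N => ?_
  have h : ∀ n : ℕ, (((n + 1) * (n + 2) : ℕ) : ℝ≥0∞)⁻¹ =
      ENNReal.ofReal ((((n : ℝ) + 1) * (n + 2))⁻¹) := fun n => by
    rw [ENNReal.ofReal_inv_of_pos (by positivity), ← ENNReal.ofReal_natCast]
    push_cast
    rfl
  simp only [h]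
  rw [← ENNReal.ofReal_sum_of_nonneg fun n _ => by positivity, ENNReal.ofReal_le_one]
  have h2 : ∑ n ∈ Finset.range N, (((n : ℝ) + 1) * (n + 2))⁻¹ = 1 - ((N : ℝ) + 1)⁻¹ := by
    induction N with
    | zero => simp
    | succ N ih =>
      rw [Finset.sum_range_succ, ih]
      push_cast
      field_simp
      ring
  rw [h2]
  have : (0 : ℝ) ≤ ((N : ℝ) + 1)⁻¹ := by positivity
  linarith

theorem uniformMeasure_path_initSeg_le {S : StringTree} (hu : S.LevelwiseUniformlyBranching)
    (hS : S.NoLeaves) (τ : List ℕ) (n : ℕ) :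
    S.uniformMeasure {g | S.IsPath g ∧ initSeg g n = τ} ≤ ((S.level n).ncard : ℝ≥0∞)⁻¹ := by
  by_cases h : τ ∈ S.carrier ∧ τ.length = n
  · obtain ⟨h1, rfl⟩ := h
    rw [← uniformMeasure_cylinder_eq hu hS h1]
    exact measure_mono fun g hg => hg.2
  · have : {g | S.IsPath g ∧ initSeg g n = τ} = ∅ := by
      refine Set.eq_empty_iff_forall_notMem.2 fun g hg => h ?_
      rw [← hg.2]
      exact initSeg_mem_level hg.1 n
    rw [this, measure_empty]
    exact zero_le

theorem uniformMeasure_compressible_level_le {S : StringTree}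
    (hu : S.LevelwiseUniformlyBranching) (hS : S.NoLeaves) (r : List Bool → ℕ → ℕ) (b n : ℕ) :
    S.uniformMeasure {g | S.IsPath g ∧ initSeg g n ∈ S.compressible r b} ≤
      (2⁻¹ : ℝ≥0∞) ^ b * (((n + 1) * (n + 2) : ℕ) : ℝ≥0∞)⁻¹ := by
  set s := (S.level n).ncard with hs
  set K := (n + 1) * (n + 2) with hK
  set X := s / (2 ^ b * K) with hX
  -- `A i` collects the paths captured at level n by the program with number i. A program has at
  -- most one output, so `A i` lies in a single cylinder.
  let A : ℕ → Set (ℕ → ℕ) := fun i =>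
    {g | S.IsPath g ∧ ∃ q u, bitsVal q = i ∧ u ∈ universalMachine q ∧
      initSeg g n = initSeg (r u) n}
  have hA : ∀ i, S.uniformMeasure (A i) ≤ (s : ℝ≥0∞)⁻¹ := by
    intro i
    by_cases h : ∃ q u, bitsVal q = i ∧ u ∈ universalMachine q
    · obtain ⟨q, u, hq, hqu⟩ := h
      refine le_trans (measure_mono ?_)
        (uniformMeasure_path_initSeg_le hu hS (initSeg (r u) n) n)
      rintro g ⟨hg, q', u', hq', hqu', he⟩
      obtain rfl := bitsVal_injective (hq'.trans hq.symm)
      exact ⟨hg, by rw [he, Part.mem_unique hqu hqu']⟩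
    · have : A i = ∅ := Set.eq_empty_iff_forall_notMem.2 fun g hg => by
        obtain ⟨-, q, u, hq, hqu, -⟩ := hg
        exact h ⟨q, u, hq, hqu⟩
      rw [this, measure_empty]
      exact zero_le
  have hcov : {g | S.IsPath g ∧ initSeg g n ∈ S.compressible r b} ⊆
      ⋃ i ∈ Finset.range X, A i := by
    rintro g ⟨hg, q, u, hqu, he, hc⟩
    rw [length_initSeg] at he hc
    refine Set.mem_biUnion (x := bitsVal q) ?_ ⟨hg, q, u, rfl, hqu, he.symm⟩
    -- A program admitted by the test thus has number at most X - 2, so X sets `A i` suffice.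
    have h1 : 2 ^ (q.length + 1) ≤ X := by
      rw [hX, Nat.le_div_iff_mul_le (by positivity)]
      calc 2 ^ (q.length + 1) * (2 ^ b * K) = 2 ^ (q.length + b + 1) * K := by ring
        _ ≤ s := hc
    have h2 := bitsVal_add_two_le q
    simp only [Finset.coe_range, Set.mem_Iio]
    omega
  have hs0 : s ≠ 0 := ((Set.ncard_pos (S.finite_level n)).2 (by
    obtain ⟨f, hf, -⟩ := exists_isPath_initSeg_eq hS S.nil_mem
    exact ⟨_, initSeg_mem_level hf n⟩)).ne'
  calc S.uniformMeasure {g | S.IsPath g ∧ initSeg g n ∈ S.compressible r b}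
      ≤ ∑ i ∈ Finset.range X, S.uniformMeasure (A i) :=
        (measure_mono hcov).trans (measure_biUnion_finset_le _ _)
    _ ≤ X * (s : ℝ≥0∞)⁻¹ := by
        refine (Finset.sum_le_sum fun i _ => hA i).trans ?_
        rw [Finset.sum_const, Finset.card_range, nsmul_eq_mul]
    _ ≤ ((2 ^ b * K : ℕ) : ℝ≥0∞)⁻¹ := by
        rw [← div_eq_mul_inv, ENNReal.div_le_iff (by exact_mod_cast hs0) (ENNReal.natCast_ne_top _),
          ← ENNReal.div_eq_inv_mul, ENNReal.le_div_iff_mul_le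
            (Or.inl (by rw [Nat.cast_ne_zero]; positivity)) (Or.inl (ENNReal.natCast_ne_top _))]
        exact_mod_cast Nat.div_mul_le_self s (2 ^ b * K)
    _ = (2⁻¹ : ℝ≥0∞) ^ b * (K : ℝ≥0∞)⁻¹ := by
        rw [Nat.cast_mul, ENNReal.mul_inv (Or.inr (ENNReal.natCast_ne_top _))
          (Or.inl (ENNReal.natCast_ne_top _)), Nat.cast_pow, ← ENNReal.inv_pow, Nat.cast_ofNat]

theorem isMLTest_compressible {S : StringTree} (hu : S.LevelwiseUniformlyBranching)
    (hS : S.NoLeaves) (hSc : S.IsComputable) {r : List Bool → ℕ → ℕ} (hr : Computable₂ r) :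
    IsMLTest S (S.compressible r) where
  re := rePred_compressible hSc hr
  measure_le b := by
    have h : {g | S.IsPath g ∧ ∃ n, initSeg g n ∈ S.compressible r b} =
        ⋃ n, {g | S.IsPath g ∧ initSeg g n ∈ S.compressible r b} := by
      ext g
      simp
    rw [h]
    calc _ ≤ ∑' n, S.uniformMeasure {g | S.IsPath g ∧ initSeg g n ∈ S.compressible r b} :=
          measure_iUnion_le _
      _ ≤ ∑' n : ℕ, (2⁻¹ : ℝ≥0∞) ^ b * (((n + 1) * (n + 2) : ℕ) : ℝ≥0∞)⁻¹ :=
          ENNReal.tsum_le_tsum fun n => uniformMeasure_compressible_level_le hu hS r b n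
      _ ≤ (2⁻¹ : ℝ≥0∞) ^ b := by
          rw [ENNReal.tsum_mul_left]
          exact mul_le_of_le_one_right' ENNReal.tsum_inv_succ_mul_succ_succ_le

/-- The index b at which f escapes the test serves all levels at once; apply this to a shortest
program for `u`. -/
theorem exists_ncard_level_lt_of_isMLRandom {S : StringTree}
    (hu : S.LevelwiseUniformlyBranching) (hS : S.NoLeaves) (hSc : S.IsComputable)
    {r : List Bool → ℕ → ℕ} (hr : Computable₂ r) {f : ℕ → ℕ} (hf : IsMLRandom S f) :
    ∃ b : ℕ, ∀ n u, initSeg (r u) n = initSeg f n →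
      (S.level n).ncard < 2 ^ (plainComplexity u + b + 1) * ((n + 1) * (n + 2)) := by
  obtain ⟨b, hb⟩ := hf.2 _ (isMLTest_compressible hu hS hSc hr)
  refine ⟨b, fun n u h => ?_⟩
  by_contra! hn
  obtain ⟨q, hq, hl⟩ := exists_program u
  exact hb n ⟨q, u, hq, by rw [length_initSeg, h], by rwa [length_initSeg, hl]⟩

end StringTree

/-! ### Limits up to a vanishing error -/

section Limits

variable {ι : Type*} {l : Filter ι} {u v e : ι → ℝ}

theorem limsup_coe_eq_zero_of_tendsto [l.NeBot] (he : Tendsto e l (𝓝 0)) :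
    limsup (fun x => (e x : EReal)) l = 0 :=
  ((continuous_coe_real_ereal.tendsto 0).comp he).limsup_eq

/-- Bounding the error by its limsup, which is 0, leaves the liminf of `v` and rules out the form ∞
- ∞ in the extended reals. -/
theorem liminf_coe_le_of_le_add [l.NeBot] (h : ∀ᶠ x in l, u x ≤ v x + e x)
    (he : Tendsto e l (𝓝 0)) :
    liminf (fun x => (u x : EReal)) l ≤ liminf (fun x => (v x : EReal)) l := by
  have h0 := limsup_coe_eq_zero_of_tendsto he
  calc liminf (fun x => (u x : EReal)) l
      ≤ liminf ((fun x => (e x : EReal)) + fun x => (v x : EReal)) l := by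
        refine liminf_le_liminf (h.mono fun x hx => ?_)
        rw [Pi.add_apply, ← EReal.coe_add, add_comm (e x)]
        exact_mod_cast hx
    _ ≤ limsup (fun x => (e x : EReal)) l + liminf (fun x => (v x : EReal)) l :=
        EReal.liminf_add_le (Or.inl (by simp [h0])) (Or.inl (by simp [h0]))
    _ = _ := by rw [h0, zero_add]

theorem limsup_coe_le_of_le_add [l.NeBot] (h : ∀ᶠ x in l, u x ≤ v x + e x)
    (he : Tendsto e l (𝓝 0)) :
    limsup (fun x => (u x : EReal)) l ≤ limsup (fun x => (v x : EReal)) l := by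
  have h0 := limsup_coe_eq_zero_of_tendsto he
  calc limsup (fun x => (u x : EReal)) l
      ≤ limsup ((fun x => (e x : EReal)) + fun x => (v x : EReal)) l := by
        refine limsup_le_limsup (h.mono fun x hx => ?_)
        rw [Pi.add_apply, ← EReal.coe_add, add_comm (e x)]
        exact EReal.coe_le_coe_iff.2 hx
    _ ≤ limsup (fun x => (e x : EReal)) l + limsup (fun x => (v x : EReal)) l :=
        EReal.limsup_add_le (Or.inl (by simp [h0])) (Or.inl (by simp [h0]))
    _ = _ := by rw [h0, zero_add]

end Limits

theorem tendsto_logb_one_div_atTop :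
    Tendsto (fun α : ℝ => Real.logb 2 (1 / α)) (𝓝[>] 0) atTop := by
  simp only [one_div]
  exact (Real.tendsto_logb_atTop one_lt_two).comp tendsto_inv_nhdsGT_zero

theorem tendsto_logarithmic_error (c : ℝ) :
    Tendsto (fun α : ℝ => (2 * Real.logb 2 (Real.logb 2 (1 / α) + 3) + c) /
      Real.logb 2 (1 / α)) (𝓝[>] 0) (𝓝 0) := by
  have h1 : Tendsto (fun x : ℝ => (2 * Real.logb 2 (x + 3) + c) / x) atTop (𝓝 0) := by
    have h2 : Tendsto (fun x : ℝ => Real.log (x + 3) / x) atTop (𝓝 0) := by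
      -- Substitute y = x + 3, so that the denominator y - 3 is x.
      have h3 : Tendsto (fun y : ℝ => Real.log y ^ 1 / (1 * y + (-3))) atTop (𝓝 0) :=
        Real.tendsto_pow_log_div_mul_add_atTop 1 (-3) 1 one_ne_zero
      refine (h3.comp (tendsto_atTop_add_const_right atTop (3 : ℝ) tendsto_id)).congr fun x => ?_
      simp
    have h4 : Tendsto (fun x : ℝ => c / x) atTop (𝓝 0) := tendsto_id.const_div_atTop c
    have h5 := (h2.const_mul (2 / Real.log 2)).add h4
    rw [mul_zero, add_zero] at h5
    refine h5.congr fun x => ?_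
    rw [Real.logb]
    ring
  exact h1.comp tendsto_logb_one_div_atTop

/-! ### Complexity quotients against covering quotients -/

namespace StringTree

section Main

variable {T S : StringTree} (hT2 : ∀ σ ∈ T.carrier, 2 ≤ (T.succs σ).ncard)
  {r : List Bool → T.Path} (hr : T.IsComputableStructure r)
include hT2

/-- The dimension quotient of a covering: `log₂ |S_n| / log₂ (1 / α)` for the level `n` of precision
`α`. -/
noncomputable def levelQuotient (T S : StringTree) (α : ℝ) : ℝ :=
  Real.logb 2 ((S.level (T.precisionLevel α)).ncard : ℝ) / Real.logb 2 (1 / α)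

theorem log_coverNumber_div_eventuallyEq (hST : S.carrier ⊆ T.carrier) (hS : S.NoLeaves) :
    (fun α : ℝ => ENNReal.log (coverNumber (S.pathsIn T) α : ℝ≥0∞) /
      (Real.log (1 / α) : EReal)) =ᶠ[𝓝[>] 0] fun α => (levelQuotient T S α : EReal) := by
  filter_upwards [self_mem_nhdsWithin] with α hα
  have hs : 0 < (S.level (T.precisionLevel α)).ncard :=
    (Set.ncard_pos (S.finite_level _)).2 (by
      obtain ⟨f, hf, -⟩ := exists_isPath_initSeg_eq hS S.nil_mem
      exact ⟨_, initSeg_mem_level hf _⟩)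
  have h2 : Real.log 2 ≠ 0 := (Real.log_pos one_lt_two).ne'
  rw [coverNumber_pathsIn hT2 hST hS hα, ENat.toENNReal_coe, ← ENNReal.ofReal_natCast,
    ENNReal.log_ofReal_of_pos (by exact_mod_cast hs), ← EReal.coe_div, levelQuotient, Real.logb,
    Real.logb, div_div_div_cancel_right₀ h2]

theorem lowerBoxDim_pathsIn (hST : S.carrier ⊆ T.carrier) (hS : S.NoLeaves) :
    lowerBoxDim (S.pathsIn T) = liminf (fun α => (levelQuotient T S α : EReal)) (𝓝[>] 0) :=
  liminf_congr (log_coverNumber_div_eventuallyEq hT2 hST hS)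

theorem upperBoxDim_pathsIn (hST : S.carrier ⊆ T.carrier) (hS : S.NoLeaves) :
    upperBoxDim (S.pathsIn T) = limsup (fun α => (levelQuotient T S α : EReal)) (𝓝[>] 0) :=
  limsup_congr (log_coverNumber_div_eventuallyEq hT2 hST hS)

/-- Source of the 3 in the error term: both factors n + 1 and n + 2 are at most log₂(1/α) + 3. -/
theorem precisionLevel_add_le {α : ℝ} (hα : 0 < α) (hα1 : α ≤ 1) :
    (T.precisionLevel α : ℝ) + 2 ≤ Real.logb 2 (1 / α) + 3 := by
  have := precisionLevel_le_logb hT2 hα hα1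
  linarith

include hr

theorem exists_complexity_quotient_le (hS : S.IsComputable) {f : T.Path}
    (hf : f ∈ S.pathsIn T) : ∃ c : ℝ, ∀ᶠ α : ℝ in 𝓝[>] 0,
      (complexityAtPrecision r f α : ℝ) / Real.logb 2 (1 / α) ≤ levelQuotient T S α +
        (2 * Real.logb 2 (Real.logb 2 (1 / α) + 3) + c) / Real.logb 2 (1 / α) := by
  obtain ⟨c, hc⟩ := exists_plainComplexity_le hT2 hr hS
  refine ⟨c, ?_⟩
  filter_upwards [self_mem_nhdsWithin, mem_nhdsWithin_of_mem_nhds (Iio_mem_nhds one_pos),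
    tendsto_logb_one_div_atTop.eventually_gt_atTop 0] with α hα hα1 hL
  set n := T.precisionLevel α
  obtain ⟨u, hu, a, b, h1, h2, h3⟩ := hc f hf n
  have h4 : complexityAtPrecision r f α ≤ plainComplexity u :=
    complexityAtPrecision_le ((dist_le_iff_initSeg hT2 hα).2 hu.symm)
  have h5 : (complexityAtPrecision r f α : ℝ) ≤ 2 * a + b + c := by exact_mod_cast h4.trans h1
  have hs : (2 : ℝ) ^ b ≤ ((S.level n).ncard : ℝ) := by exact_mod_cast h3
  have hb : (b : ℝ) ≤ Real.logb 2 ((S.level n).ncard : ℝ) := by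
    rw [Real.le_logb_iff_rpow_le one_lt_two (lt_of_lt_of_le (by positivity) hs),
      Real.rpow_natCast]
    exact hs
  have ha : (a : ℝ) ≤ Real.logb 2 (Real.logb 2 (1 / α) + 3) := by
    rw [Real.le_logb_iff_rpow_le one_lt_two (by linarith), Real.rpow_natCast]
    have h6 : (2 : ℝ) ^ a ≤ n + 1 := by exact_mod_cast h2
    have h7 := precisionLevel_add_le hT2 hα (le_of_lt hα1)
    linarith
  rw [levelQuotient, ← add_div]
  gcongr
  linarith

theorem exists_levelQuotient_le (hu : S.LevelwiseUniformlyBranching) (hSc : S.IsComputable)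
    (hS : S.NoLeaves) {f : T.Path} (hf : IsMLRandom S f.1) : ∃ c : ℝ, ∀ᶠ α : ℝ in 𝓝[>] 0,
      levelQuotient T S α ≤ (complexityAtPrecision r f α : ℝ) / Real.logb 2 (1 / α) +
        (2 * Real.logb 2 (Real.logb 2 (1 / α) + 3) + c) / Real.logb 2 (1 / α) := by
  have hrc : Computable₂ fun (u : List Bool) (n : ℕ) => (r u).1 n := hr.computable
  obtain ⟨b, hb⟩ := exists_ncard_level_lt_of_isMLRandom hu hS hSc hrc hf
  refine ⟨b + 1, ?_⟩
  filter_upwards [self_mem_nhdsWithin, mem_nhdsWithin_of_mem_nhds (Iio_mem_nhds one_pos),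
    tendsto_logb_one_div_atTop.eventually_gt_atTop 0] with α hα hα1 hL
  set n := T.precisionLevel α
  -- The optimal name at precision α is a path through f↾n, so randomness bounds its complexity from
  -- below.
  obtain ⟨u, hu1, hu2⟩ := exists_complexityAtPrecision_eq hr.dense f hα
  have h1 := hb n u ((dist_le_iff_initSeg hT2 hα).1 hu1).symm
  rw [hu2] at h1
  set C := complexityAtPrecision r f α
  set L := Real.logb 2 (1 / α)
  have hs : 0 < (S.level n).ncard :=
    (Set.ncard_pos (S.finite_level _)).2 ⟨_, initSeg_mem_level hf.1 n⟩
  have h7 := precisionLevel_add_le hT2 hα (le_of_lt hα1)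
  have h2 : ((S.level n).ncard : ℝ) ≤ 2 ^ (C + b + 1) * ((L + 3) * (L + 3)) := by
    have h3 : ((S.level n).ncard : ℝ) ≤ 2 ^ (C + b + 1) * (((n : ℝ) + 1) * (n + 2)) := by
      exact_mod_cast h1.le
    refine h3.trans ?_
    gcongr 2 ^ (C + b + 1) * (?_ * ?_)
    linarith
  have h4 : Real.logb 2 ((S.level n).ncard : ℝ) ≤ (C + b + 1) + 2 * Real.logb 2 (L + 3) := by
    have hL3 : L + 3 ≠ 0 := by positivity
    refine (Real.logb_le_logb_of_le one_lt_two (by exact_mod_cast hs) h2).trans_eq ?_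
    rw [Real.logb_mul (by positivity) (by positivity), Real.logb_mul hL3 hL3, ← Real.rpow_natCast,
      Real.logb_rpow two_pos (by norm_num)]
    push_cast
    ring
  rw [levelQuotient, ← add_div]
  gcongr
  linarith

end Main

end StringTree

theorem mainTheorem3 (T S : StringTree)
    (hT : T.IsComputable) (hT2 : ∀ σ ∈ T.carrier, 2 ≤ (T.succs σ).ncard)
    (r : List Bool → T.Path) (hr : T.IsComputableStructure r)
    (hS : S.IsComputable) (hST : S.carrier ⊆ T.carrier) (hS1 : S.NoLeaves) :
    (∀ f ∈ S.pathsIn T,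
      algDim r f ≤ lowerBoxDim (S.pathsIn T) ∧
      strongAlgDim r f ≤ upperBoxDim (S.pathsIn T)) ∧
    (S.LevelwiseUniformlyBranching → ∀ f ∈ S.pathsIn T, IsMLRandom S f.1 →
      algDim r f = lowerBoxDim (S.pathsIn T) ∧
      strongAlgDim r f = upperBoxDim (S.pathsIn T)) := by
  rw [StringTree.lowerBoxDim_pathsIn hT2 hST hS1, StringTree.upperBoxDim_pathsIn hT2 hST hS1]
  have upper : ∀ f ∈ S.pathsIn T,
      algDim r f ≤ liminf (fun α => (StringTree.levelQuotient T S α : EReal)) (𝓝[>] 0) ∧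
      strongAlgDim r f ≤
        limsup (fun α => (StringTree.levelQuotient T S α : EReal)) (𝓝[>] 0) := by
    intro f hf
    obtain ⟨c, hc⟩ := StringTree.exists_complexity_quotient_le hT2 hr hS hf
    exact ⟨liminf_coe_le_of_le_add hc (tendsto_logarithmic_error c),
      limsup_coe_le_of_le_add hc (tendsto_logarithmic_error c)⟩
  refine ⟨upper, fun hu f hf hfr => ?_⟩
  obtain ⟨c, hc⟩ := StringTree.exists_levelQuotient_le hT2 hr hu hS hS1 hfr
  exact ⟨(upper f hf).1.antisymm (liminf_coe_le_of_le_add hc (tendsto_logarithmic_error c)),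
    (upper f hf).2.antisymm (limsup_coe_le_of_le_add hc (tendsto_logarithmic_error c))⟩
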